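/- **Setting.** Let $n$ be even, $d\ge 0$. A parallel architecture on $n$ qubits of depth $d$ partitions, for each layer $m=1,\dots,d$, the $n$ qubits into pairs (the partition may depend on $m$). A Haar-random circuit on it (ensemble $\mathcal B$) has layer unitaries $U_m$ that are tensor products of two-qubit gates acting on these pairs, all gates being independent and Haar distributed. For each layer let $p_m$ be an arbitrary probability distribution over the $n$-qubit Pauli strings $E\in\{I,X,Y,Z\}^{\otimes n}$, and let $\mathcal E_m(\rho)=\sum_E p_m(E)\,E\rho E^\dagger$ be the corresponding Pauli error channel. With $\mathcal C_m(\rho)=U_m\rho U_m^\dagger$, let $p_x=\langle x|(\mathcal E_d\circ\mathcal C_d\circ\cdots\circ\mathcal E_1\circ\mathcal C_1)(|0\cdots0\rangle\langle 0\cdots 0|)|x\rangle$ for $x\in\{0,1\}^n$ be the output probabilities and $Z(U,\mathcal E)=\sum_{x} p_x^2$ the collision probability. $Z(U,\mathbb I)$ denotes the collision probability of the same circuit without noise (all $\mathcal E_m$ replaced by the identity). A family of such random circuit ensembles (possibly with different $n$, $d$, architectures and noise) is called *anticoncentrated* if there are constants $\alpha\in(0,1]$ and $c'>0$ such that $\Pr_{\mathcal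 B}[p_{0\cdots 0}\ge \alpha/2^n]\ge c'$ for all its members. **Theorem.** Haar-random circuits with Pauli noise anticoncentrate at least as fast as those without noise: 1. For every parallel architecture and every Pauli noise, $2^{-n}\le \mathbb E_{\mathcal B}[Z(U,\mathcal E)]\le \mathbb E_{\mathcal B}[Z(U,\mathbb I)]$. 2. If $2^n\,\mathbb E_{\mathcal B}[Z(U,\mathbb I)]\le c$, then $\mathbb E_{\mathcal B}[Z(U,\mathcal E)]\le c\,2^{-n}$ and, for all $0\le\alpha\le 1$, the noisy output probability satisfies $$\Pr_{\mathcal B}\Big[p_{0\cdots0}\ge \frac{\alpha}{2^n}\Big]\ \ge\ \frac{(1-\alpha)^2}{c}.$$ 3. Consequently, if in a family of such ensembles $2^n\,\mathbb E_{\mathcal B}[Z(U,\mathbb I)]\le c$ holds with one constant $c$ for all members, then the family of noisy ensembles is anticoncentrated, whatever the Pauli noise of each member. 4. Adding Pauli noise to a Clifford circuit cannot increase its collision probability: for all $n,d\geq 0$, if $U_1,\dots,U_d$ are Clifford unitaries on $n$ qubits (unitaries that map the $n$-qubit Pauli group into itself under conjugation), then $Z(U,\mathcal E)\le Z(U,\mathbb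 I)$ for every Pauli noise $\mathcal E$. -/

import Mathlib

open MeasureTheory Matrix

noncomputable section

/-! ## Qubits, Pauli matrices and channels -/

/-- Computational basis labels of `n` qubits, i.e. bit strings of length `n`. -/
abbrev BitString (n : ℕ) : Type := Fin n → Fin 2

/-- Operators on the Hilbert space of `n` qubits, in the computational basis. -/
abbrev QubitMatrix (n : ℕ) : Type := Matrix (BitString n) (BitString n) ℂ

/-- Labels of the four single-qubit Pauli matrices. -/
inductive Pauli : Type
  | I | X | Y | Z
  deriving DecidableEq

instance : Fintype Pauli where
  elems := {.I, .X, .Y, .Z}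
  complete := by intro a; cases a <;> simp

/-- The single-qubit Pauli matrices. -/
def Pauli.toMatrix : Pauli → Matrix (Fin 2) (Fin 2) ℂ
  | .I => !![1, 0; 0, 1]
  | .X => !![0, 1; 1, 0]
  | .Y => !![0, -Complex.I; Complex.I, 0]
  | .Z => !![1, 0; 0, -1]

/-- Pauli strings on `n` qubits, i.e. elements of the Pauli group modulo phases. -/
abbrev PauliString (n : ℕ) : Type := Fin n → Pauli

/-- The tensor product `E_1 ⊗ ⋯ ⊗ E_n` of Pauli matrices. -/
def PauliString.toMatrix {n : ℕ} (E : PauliString n) : QubitMatrix n :=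
  Matrix.of fun x y => ∏ i, (E i).toMatrix (x i) (y i)

/-- The Pauli group on `n` qubits: Pauli strings with a phase `1`, `i`, `-1` or `-i`. -/
def pauliGroup (n : ℕ) : Set (QubitMatrix n) :=
  {M | ∃ (k : Fin 4) (E : PauliString n), M = Complex.I ^ (k : ℕ) • E.toMatrix}

/-- A Clifford unitary: conjugation by it sends Pauli group elements to Pauli group elements. -/
def IsClifford {n : ℕ} (V : QubitMatrix n) : Prop :=
  V ∈ Matrix.unitaryGroup (BitString n) ℂ ∧ ∀ P ∈ pauliGroup n, V * P * Vᴴ ∈ pauliGroup n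

/-- The Pauli error channel `ρ ↦ ∑ E, q(E) E ρ E†` of a probability distribution `q` over
Pauli strings. (A phase of `E` would cancel between `E` and `E†`.) -/
def pauliChannel {n : ℕ} (q : stdSimplex ℝ (PauliString n)) (ρ : QubitMatrix n) : QubitMatrix n :=
  ∑ E : PauliString n, ((q.1 E : ℝ) : ℂ) • (E.toMatrix * ρ * E.toMatrixᴴ)

/-! ## Circuits, output probabilities, collision probability -/

/-- The state `(𝓔_d ∘ 𝓒_d ∘ ⋯ ∘ 𝓔_1 ∘ 𝓒_1)(|0…0⟩⟨0…0|)`, where `𝓒_m(ρ) = U_m ρ U_m†`. -/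
def outputState {n d : ℕ} (U : Fin d → QubitMatrix n)
    (𝓔 : Fin d → QubitMatrix n → QubitMatrix n) : QubitMatrix n :=
  Fin.foldl d (fun ρ m => 𝓔 m (U m * ρ * (U m)ᴴ)) (Matrix.single 0 0 1)

/-- The probability `p_x` of observing `x` when the output state is measured in the
computational basis, i.e. the (real) diagonal entry `⟨x|ρ|x⟩`. -/
def outputProb {n d : ℕ} (U : Fin d → QubitMatrix n)
    (𝓔 : Fin d → QubitMatrix n → QubitMatrix n) (x : BitString n) : ℝ :=
  (outputState U 𝓔 x x).re

/-- The collision probability `Z(U, 𝓔) = ∑ x, p_x ^ 2`. -/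
def collisionProb {n d : ℕ} (U : Fin d → QubitMatrix n)
    (𝓔 : Fin d → QubitMatrix n → QubitMatrix n) : ℝ :=
  ∑ x : BitString n, outputProb U 𝓔 x ^ 2

/-! ## Haar-random two-qubit gates -/

/-- Two-qubit gates: unitaries on the space with basis labelled by the values of two bits. -/
abbrev TwoQubitGate : Type := Matrix.unitaryGroup (BitString 2) ℂ

instance : CompactSpace TwoQubitGate := by
  have hc : IsCompact (X := Matrix (BitString 2) (BitString 2) ℂ)
      (Set.univ.pi fun _ : BitString 2 => Set.univ.pi fun _ : BitString 2 =>
        Metric.closedBall (0 : ℂ) 1) :=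
    isCompact_univ_pi fun _ => isCompact_univ_pi fun _ => isCompact_closedBall (0 : ℂ) 1
  refine isCompact_iff_compactSpace.mp
    (hc.of_isClosed_subset (isClosed_unitary (R := Matrix (BitString 2) (BitString 2) ℂ)) ?_)
  intro U hU i _ j _
  simpa using entry_norm_bound_of_unitary hU i j

/-- The Borel σ-algebra on the group of two-qubit gates. -/
instance : MeasurableSpace TwoQubitGate := borel _

instance : BorelSpace TwoQubitGate := ⟨rfl⟩

/-- The Haar probability measure on the group of two-qubit gates. -/
def haarGate : Measure TwoQubitGate := Measure.haarMeasure ⊤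

instance : IsProbabilityMeasure haarGate :=
  ⟨by simpa [haarGate] using
    Measure.haarMeasure_self (K₀ := (⊤ : TopologicalSpace.PositiveCompacts TwoQubitGate))⟩

/-! ## Noisy Haar-random circuits on parallel architectures -/

/-- A parallel architecture: `n` qubits and `d` layers; in every layer the qubits are grouped
into ordered pairs, the grouping may depend on the layer, and every qubit is in exactly one pair.
The `g`-th gate of layer `m` acts on the qubits `wire m (g, 0)` and `wire m (g, 1)`. -/
structure ParallelArchitecture where
  /-- the number of qubits -/
  n : ℕ
  /-- the number of qubits is even -/
  even_n : Even n
  /-- the depth -/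
  d : ℕ
  /-- the grouping of the qubits into pairs, layer by layer -/
  wire : Fin d → (Fin (n / 2) × Fin 2 ≃ Fin n)

namespace ParallelArchitecture

variable (A : ParallelArchitecture)

/-- A choice of a two-qubit gate for every layer and every pair of qubits of that layer. -/
abbrev Gates : Type := Fin A.d → Fin (A.n / 2) → TwoQubitGate

/-- The ensemble `𝓑`: all gates are independent and Haar distributed. -/
def haar : Measure A.Gates := Measure.pi fun _ => Measure.pi fun _ => haarGate

/-- The unitary `U_m` of layer `m`: the tensor product of the gates of that layer, each acting
on its pair of qubits. -/
def layer (u : A.Gates) (m : Fin A.d) : QubitMatrix A.n :=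
  Matrix.of fun x y => ∏ g : Fin (A.n / 2),
    (u m g : Matrix (BitString 2) (BitString 2) ℂ)
      (fun b => x (A.wire m (g, b))) (fun b => y (A.wire m (g, b)))

/-- Pauli noise: for every layer a probability distribution over Pauli strings on all qubits. -/
abbrev PauliNoise : Type := Fin A.d → stdSimplex ℝ (PauliString A.n)

/-- The sequence of noise channels; one channel follows every layer of gates. -/
abbrev Channels : Type := Fin A.d → QubitMatrix A.n → QubitMatrix A.n

variable {A} in
/-- The Pauli error channels of a Pauli noise. -/
def PauliNoise.channels (p : A.PauliNoise) : A.Channels := fun m => pauliChannel (p m)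

/-- The absence of noise, `𝕀`. -/
def noiseless : A.Channels := fun _ => id

/-- The expected collision probability `𝔼_𝓑[Z(U, 𝓔)]`. -/
def expCollision (𝓔 : A.Channels) : ℝ := ∫ u, collisionProb (A.layer u) 𝓔 ∂A.haar

/-- The probability `Pr_𝓑[p_{0…0} ≥ t]`. -/
def probZeroGe (𝓔 : A.Channels) (t : ℝ) : ℝ :=
  A.haar.real {u | t ≤ outputProb (A.layer u) 𝓔 0}

end ParallelArchitecture

/-- A family of random circuit ensembles is anticoncentrated if there are constants `α ∈ (0, 1]`
and `c > 0` with `Pr_𝓑[p_{0…0} ≥ α / 2 ^ n] ≥ c` throughout the family. -/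
def IsAnticoncentrated {ι : Type*} (A : ι → ParallelArchitecture)
    (𝓔 : ∀ k, (A k).Channels) : Prop :=
  ∃ α ∈ Set.Ioc (0 : ℝ) 1, ∃ c > (0 : ℝ), ∀ k, c ≤ (A k).probZeroGe (𝓔 k) (α / 2 ^ (A k).n)

end

/-!
Noise after a layer is a random choice of a Pauli string, so expanding all Pauli channels writes the
noisy output distribution as a mixture of the output distributions of noiseless circuits
`E_1 U_1, …, E_d U_d`, where the Pauli strings `E_m` are drawn from the noise
(`outputState_pauliChannel`). The collision probability is convex in the output distribution, hence
at most the average of the collision probabilities of those circuits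
(`collisionProb_pauliChannel_le`). It then suffices that inserting fixed Pauli strings does not
matter:

* In the Haar ensemble a Pauli string after a layer is a tensor product of fixed two-qubit gates, one
  on each pair, and left invariance of the Haar measure absorbs it
  (`ParallelArchitecture.integral_insertPaulis`).
* In a Clifford circuit the inserted strings can be pushed to the end, where they form one element
  of the Pauli group, which only translates the output distribution
  (`exists_outputState_insertPaulis`).

The lower bound `2⁻ⁿ` is the Cauchy–Schwarz inequality for a distribution on `2ⁿ` outcomes.

Anticoncentration is the Paley–Zygmund inequality (`sq_integral_sub_le_integral_sq_mul`) for
`p_{0…0}`. Its first two moments are `2⁻ⁿ` and `2⁻ⁿ 𝔼[Z]`: left invariance under `X` gates after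
the last layer makes all `p_x` identically distributed
(`ParallelArchitecture.integral_outputProb_eq`). Only a circuit of depth `0` has to be treated
separately.
-/

noncomputable section

/-! ### Pauli strings as monomial unitaries -/

namespace Pauli

/-- The bit by which a Pauli matrix shifts computational basis states: `1` for `X` and `Y`. -/
def flip : Pauli → Fin 2
  | .I => 0
  | .X => 1
  | .Y => 1
  | .Z => 0

/-- The only nonzero entry of a Pauli matrix in the given row. -/
def phase : Pauli → Fin 2 → ℂ
  | .I, _ => 1
  | .X, _ => 1
  | .Y, a => if a = 0 then -Complex.I else Complex.I
  | .Z, a => if a = 0 then 1 else -1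

lemma toMatrix_apply (P : Pauli) (a b : Fin 2) :
    P.toMatrix a b = if b = a + P.flip then P.phase a else 0 := by
  cases P <;> fin_cases a <;> fin_cases b <;> simp [toMatrix, flip, phase]

lemma phase_mul_star (P : Pauli) (a : Fin 2) : P.phase a * star (P.phase a) = 1 := by
  cases P <;> fin_cases a <;> simp [phase]

lemma toMatrix_mul_conjTranspose (P : Pauli) : P.toMatrix * P.toMatrixᴴ = 1 := by
  cases P <;> ext a b <;> fin_cases a <;> fin_cases b <;>
    simp [toMatrix, Matrix.mul_apply, Fin.sum_univ_two]

lemma exists_toMatrix_mul (P Q : Pauli) :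
    ∃ (k : ℕ) (R : Pauli), P.toMatrix * Q.toMatrix = Complex.I ^ k • R.toMatrix := by
  have h3 : Complex.I ^ 3 = -Complex.I := by rw [pow_succ, Complex.I_sq]; ring
  cases P <;> cases Q
  on_goal 1 => refine ⟨0, .I, ?_⟩
  on_goal 2 => refine ⟨0, .X, ?_⟩
  on_goal 3 => refine ⟨0, .Y, ?_⟩
  on_goal 4 => refine ⟨0, .Z, ?_⟩
  on_goal 5 => refine ⟨0, .X, ?_⟩
  on_goal 6 => refine ⟨0, .I, ?_⟩
  on_goal 7 => refine ⟨1, .Z, ?_⟩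
  on_goal 8 => refine ⟨3, .Y, ?_⟩
  on_goal 9 => refine ⟨0, .Y, ?_⟩
  on_goal 10 => refine ⟨3, .Z, ?_⟩
  on_goal 11 => refine ⟨0, .I, ?_⟩
  on_goal 12 => refine ⟨1, .X, ?_⟩
  on_goal 13 => refine ⟨0, .Z, ?_⟩
  on_goal 14 => refine ⟨1, .Y, ?_⟩
  on_goal 15 => refine ⟨3, .X, ?_⟩
  on_goal 16 => refine ⟨0, .I, ?_⟩
  all_goals
    ext a b
    fin_cases a <;> fin_cases b <;>
      simp [toMatrix, Matrix.mul_apply, Fin.sum_univ_two, h3]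

end Pauli

namespace PauliString

variable {n : ℕ}

/-- The bit string by which a Pauli string shifts computational basis states. -/
def flip (E : PauliString n) : BitString n := fun i => (E i).flip

/-- The Pauli string `X^{x_1} ⊗ ⋯ ⊗ X^{x_n}`. -/
def ofBits (x : BitString n) : PauliString n := fun i => if x i = 0 then .I else .X

lemma flip_ofBits (x : BitString n) : (ofBits x).flip = x := by
  ext i
  rcases Fin.exists_fin_two.mp ⟨x i, rfl⟩ with h | h <;> simp [flip, ofBits, h, Pauli.flip]

lemma toMatrix_apply (E : PauliString n) (x y : BitString n) :
    E.toMatrix x y = if y = x + E.flip then ∏ i, (E i).phase (x i) else 0 := by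
  simp only [toMatrix, Matrix.of_apply, Pauli.toMatrix_apply, Finset.prod_ite_zero, funext_iff,
    Finset.mem_univ, true_imp_iff, Pi.add_apply, flip]

@[simp]
lemma toMatrix_ofBits_zero : (ofBits (0 : BitString n)).toMatrix = 1 := by
  ext x y
  rw [toMatrix_apply, flip_ofBits]
  simp [ofBits, Pauli.phase, Matrix.one_apply, eq_comm]

/-- Conjugation by a Pauli string permutes the diagonal of a matrix. -/
lemma conj_apply_diag (E : PauliString n) (ρ : QubitMatrix n) (x : BitString n) :
    (E.toMatrix * ρ * E.toMatrixᴴ) x x = ρ (x + E.flip) (x + E.flip) := by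
  have h : (∏ i, (E i).phase (x i)) * star (∏ i, (E i).phase (x i)) = 1 := by
    rw [star_prod, ← Finset.prod_mul_distrib]
    exact Finset.prod_eq_one fun i _ => Pauli.phase_mul_star _ _
  simp only [Matrix.mul_apply, Matrix.conjTranspose_apply, toMatrix_apply, ite_mul, zero_mul,
    Finset.sum_ite_eq', Finset.mem_univ, if_true, apply_ite star, star_zero,
    mul_ite, mul_zero]
  rw [mul_right_comm, h, one_mul]

lemma toMatrix_mul_conjTranspose (E : PauliString n) : E.toMatrix * E.toMatrixᴴ = 1 := by
  ext x y
  have h (i : Fin n) := congr_fun₂ (Pauli.toMatrix_mul_conjTranspose (E i)) (x i) (y i)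
  simp only [Matrix.mul_apply, Matrix.conjTranspose_apply] at h
  simp only [Matrix.mul_apply, Matrix.conjTranspose_apply, toMatrix, Matrix.of_apply, star_prod,
    ← Finset.prod_mul_distrib]
  rw [← Fintype.prod_sum (fun i z => (E i).toMatrix (x i) z * star ((E i).toMatrix (y i) z))]
  simp only [h, Matrix.one_apply, Finset.prod_ite_zero, Finset.mem_univ, true_imp_iff, funext_iff,
    Finset.prod_const_one]

lemma toMatrix_mem_unitaryGroup (E : PauliString n) :
    E.toMatrix ∈ Matrix.unitaryGroup (BitString n) ℂ :=
  Matrix.mem_unitaryGroup_iff.mpr E.toMatrix_mul_conjTranspose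

lemma exists_toMatrix_mul (E F : PauliString n) :
    ∃ (k : ℕ) (G : PauliString n), E.toMatrix * F.toMatrix = Complex.I ^ k • G.toMatrix := by
  choose k G h using fun i => Pauli.exists_toMatrix_mul (E i) (F i)
  refine ⟨∑ i, k i, G, ?_⟩
  ext x y
  have h' (i : Fin n) := congr_fun₂ (h i) (x i) (y i)
  simp only [Matrix.mul_apply, Matrix.smul_apply, smul_eq_mul] at h'
  simp only [Matrix.mul_apply, toMatrix, Matrix.of_apply, ← Finset.prod_mul_distrib,
    Matrix.smul_apply, smul_eq_mul]
  rw [← Fintype.prod_sum (fun i z => (E i).toMatrix (x i) z * (F i).toMatrix z (y i))]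
  simp only [h', Finset.prod_mul_distrib, Finset.prod_pow_eq_pow_sum]

end PauliString

lemma pow_I_smul_mem_pauliGroup {n : ℕ} (k : ℕ) (E : PauliString n) :
    Complex.I ^ k • E.toMatrix ∈ pauliGroup n :=
  ⟨⟨k % 4, Nat.mod_lt _ (by norm_num)⟩, E, by rw [← Complex.I_pow_eq_pow_mod]⟩

lemma mul_mem_pauliGroup {n : ℕ} {P Q : QubitMatrix n} (hP : P ∈ pauliGroup n)
    (hQ : Q ∈ pauliGroup n) : P * Q ∈ pauliGroup n := by
  obtain ⟨k, E, rfl⟩ := hP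
  obtain ⟨l, F, rfl⟩ := hQ
  obtain ⟨j, G, h⟩ := E.exists_toMatrix_mul F
  rw [smul_mul_smul_comm, h, smul_smul, ← pow_add, ← pow_add]
  exact pow_I_smul_mem_pauliGroup _ G

lemma conj_apply_diag_of_mem_pauliGroup {n : ℕ} {P : QubitMatrix n} (hP : P ∈ pauliGroup n) :
    ∃ s : BitString n, ∀ (ρ : QubitMatrix n) x, (P * ρ * Pᴴ) x x = ρ (x + s) (x + s) := by
  obtain ⟨k, E, rfl⟩ := hP
  refine ⟨E.flip, fun ρ x => ?_⟩
  have h : Complex.I ^ (k : ℕ) * star (Complex.I ^ (k : ℕ)) = 1 := by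
    rw [star_pow, ← mul_pow]; simp
  rw [Matrix.conjTranspose_smul, Matrix.smul_mul, Matrix.smul_mul, Matrix.mul_smul, smul_smul, h,
    one_smul, E.conj_apply_diag]

/-! ### Noisy circuits as mixtures of noiseless circuits -/

section Circuit

variable {n d : ℕ}

lemma outputState_succ (U : Fin (d + 1) → QubitMatrix n)
    (𝓔 : Fin (d + 1) → QubitMatrix n → QubitMatrix n) :
    outputState U 𝓔 = 𝓔 (Fin.last d) (U (Fin.last d) *
      outputState (fun m => U m.castSucc) (fun m => 𝓔 m.castSucc) * (U (Fin.last d))ᴴ) := by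
  simp only [outputState, Fin.foldl_succ_last]

/-- The layers of a circuit followed by one Pauli string each. -/
def insertPaulis (E : Fin d → PauliString n) (U : Fin d → QubitMatrix n) :
    Fin d → QubitMatrix n := fun m => (E m).toMatrix * U m

/-- Expanding all Pauli channels, the noisy output state is the mixture, over all ways to insert a
Pauli string after every layer, of the output states of the noiseless circuits so obtained. -/
lemma outputState_pauliChannel (U : Fin d → QubitMatrix n)
    (p : Fin d → stdSimplex ℝ (PauliString n)) :
    outputState U (fun m => pauliChannel (p m)) =
      ∑ E : Fin d → PauliString n,
        ((∏ m, (p m).1 (E m) : ℝ) : ℂ) • outputState (insertPaulis E U) (fun _ => id) := by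
  induction d with
  | zero => simp [outputState]
  | succ d ih =>
    rw [outputState_succ, ih, pauliChannel,
      ← (Fin.snocEquiv fun _ : Fin (d + 1) => PauliString n).sum_comp, Fintype.sum_prod_type]
    refine Finset.sum_congr rfl fun F _ => ?_
    simp only [Finset.mul_sum, Finset.sum_mul, Finset.smul_sum]
    refine Finset.sum_congr rfl fun E _ => ?_
    rw [outputState_succ, Fin.prod_univ_castSucc]
    simp only [insertPaulis, Fin.snocEquiv, Equiv.coe_fn_mk, Fin.snoc_last, Fin.snoc_castSucc, id,
      Matrix.mul_smul, Matrix.smul_mul, smul_smul, Complex.ofReal_mul, Matrix.conjTranspose_mul,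
      Matrix.mul_assoc]
    rw [mul_comm]
    rfl

lemma outputProb_pauliChannel (U : Fin d → QubitMatrix n)
    (p : Fin d → stdSimplex ℝ (PauliString n)) (x : BitString n) :
    outputProb U (fun m => pauliChannel (p m)) x =
      ∑ E : Fin d → PauliString n,
        (∏ m, (p m).1 (E m)) * outputProb (insertPaulis E U) (fun _ => id) x := by
  simp only [outputProb, outputState_pauliChannel, Matrix.sum_apply, Matrix.smul_apply,
    smul_eq_mul, Complex.re_sum, Complex.re_ofReal_mul]

lemma prod_stdSimplex_nonneg {ι : Type*} [Fintype ι] (p : Fin d → stdSimplex ℝ ι)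
    (E : Fin d → ι) : 0 ≤ ∏ m, (p m).1 (E m) :=
  Finset.prod_nonneg fun m _ => (p m).2.1 _

lemma sum_prod_stdSimplex {ι : Type*} [Fintype ι] (p : Fin d → stdSimplex ℝ ι) :
    ∑ E : Fin d → ι, ∏ m, (p m).1 (E m) = 1 := by
  rw [← Fintype.prod_sum (fun m e => (p m).1 e)]
  exact Finset.prod_eq_one fun m _ => (p m).2.2

/-- Convexity of the collision probability in the output distribution. -/
lemma collisionProb_pauliChannel_le (U : Fin d → QubitMatrix n)
    (p : Fin d → stdSimplex ℝ (PauliString n)) :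
    collisionProb U (fun m => pauliChannel (p m)) ≤
      ∑ E : Fin d → PauliString n,
        (∏ m, (p m).1 (E m)) * collisionProb (insertPaulis E U) (fun _ => id) := by
  simp only [collisionProb, outputProb_pauliChannel, Finset.mul_sum]
  rw [Finset.sum_comm]
  refine Finset.sum_le_sum fun x _ => ?_
  exact (even_two.convexOn_pow (𝕜 := ℝ)).map_sum_le (fun E _ => prod_stdSimplex_nonneg p E)
    (sum_prod_stdSimplex p) (fun _ _ => Set.mem_univ _)

lemma trace_outputState_id {U : Fin d → QubitMatrix n}
    (hU : ∀ m, U m ∈ Matrix.unitaryGroup (BitString n) ℂ) :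
    (outputState U (fun _ => id)).trace = 1 := by
  induction d with
  | zero => simp [outputState]
  | succ d ih =>
    have h : (U (Fin.last d))ᴴ * U (Fin.last d) = 1 :=
      Matrix.mem_unitaryGroup_iff'.mp (hU (Fin.last d))
    rw [outputState_succ, id, Matrix.trace_mul_cycle, h, Matrix.one_mul,
      ih fun m => hU m.castSucc]

lemma sum_outputProb_pauliChannel {U : Fin d → QubitMatrix n}
    (hU : ∀ m, U m ∈ Matrix.unitaryGroup (BitString n) ℂ)
    (p : Fin d → stdSimplex ℝ (PauliString n)) :
    ∑ x, outputProb U (fun m => pauliChannel (p m)) x = 1 := by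
  have h (E : Fin d → PauliString n) :
      ∑ x, outputProb (insertPaulis E U) (fun _ => id) x = 1 := by
    have := congr_arg Complex.re (trace_outputState_id (U := insertPaulis E U)
      fun m => mul_mem (E m).toMatrix_mem_unitaryGroup (hU m))
    simpa [Matrix.trace, outputProb] using this
  simp only [outputProb_pauliChannel]
  rw [Finset.sum_comm]
  simp only [← Finset.mul_sum, h, mul_one, sum_prod_stdSimplex]

lemma inv_two_pow_le_collisionProb {U : Fin d → QubitMatrix n}
    {𝓔 : Fin d → QubitMatrix n → QubitMatrix n} (h : ∑ x, outputProb U 𝓔 x = 1) :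
    (2 ^ n : ℝ)⁻¹ ≤ collisionProb U 𝓔 := by
  have hc := sq_sum_le_card_mul_sum_sq (s := Finset.univ) (f := outputProb U 𝓔)
  rw [h, Finset.card_univ] at hc
  rw [inv_le_iff_one_le_mul₀' (by positivity)]
  simpa [collisionProb] using hc

/-! ### Clifford circuits -/

/-- Pauli strings inserted into a Clifford circuit can be pushed to its end, where they merge into
a single element of the Pauli group. -/
lemma exists_outputState_insertPaulis {U : Fin d → QubitMatrix n} (hU : ∀ m, IsClifford (U m))
    (E : Fin d → PauliString n) :
    ∃ P ∈ pauliGroup n, outputState (insertPaulis E U) (fun _ => id) =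
      P * outputState U (fun _ => id) * Pᴴ := by
  induction d with
  | zero =>
    have h1 : (1 : QubitMatrix n) ∈ pauliGroup n := by
      simpa using pow_I_smul_mem_pauliGroup 0 (PauliString.ofBits (0 : BitString n))
    exact ⟨1, h1, by simp [outputState]⟩
  | succ d ih =>
    obtain ⟨P, hP, h⟩ := ih (fun m => hU m.castSucc) (fun m => E m.castSucc)
    obtain ⟨hV, hC⟩ := hU (Fin.last d)
    set V := U (Fin.last d) with hVdef
    have hE : (E (Fin.last d)).toMatrix ∈ pauliGroup n := by
      simpa using pow_I_smul_mem_pauliGroup 0 (E (Fin.last d))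
    have hV' : Vᴴ * V = 1 := Matrix.mem_unitaryGroup_iff'.mp hV
    refine ⟨(E (Fin.last d)).toMatrix * (V * P * Vᴴ), mul_mem_pauliGroup hE (hC P hP), ?_⟩
    have hVP : V * P * Vᴴ * V = V * P := by rw [Matrix.mul_assoc, hV', Matrix.mul_one]
    rw [outputState_succ, outputState_succ]
    unfold insertPaulis at h ⊢
    rw [h]
    simp only [id, ← hVdef]
    calc _ = (E (Fin.last d)).toMatrix * (V * P) * outputState (fun m => U m.castSucc)
            (fun _ => id) * ((E (Fin.last d)).toMatrix * (V * P))ᴴ := by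
          simp only [Matrix.conjTranspose_mul, Matrix.mul_assoc]
      _ = _ := by
          generalize V * P * Vᴴ = W at hVP
          rw [← hVP]
          simp only [Matrix.conjTranspose_mul, Matrix.mul_assoc]

lemma collisionProb_insertPaulis {U : Fin d → QubitMatrix n} (hU : ∀ m, IsClifford (U m))
    (E : Fin d → PauliString n) :
    collisionProb (insertPaulis E U) (fun _ => id) = collisionProb U (fun _ => id) := by
  obtain ⟨P, hP, h⟩ := exists_outputState_insertPaulis hU E
  obtain ⟨s, hs⟩ := conj_apply_diag_of_mem_pauliGroup hP
  simp only [collisionProb, outputProb, h, hs]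
  exact Equiv.sum_comp (Equiv.addRight s) fun x => (outputState U (fun _ => id) x x).re ^ 2

theorem collisionProb_pauliChannel_le_of_isClifford {U : Fin d → QubitMatrix n}
    (hU : ∀ m, IsClifford (U m)) (p : Fin d → stdSimplex ℝ (PauliString n)) :
    collisionProb U (fun m => pauliChannel (p m)) ≤ collisionProb U (fun _ => id) := by
  refine (collisionProb_pauliChannel_le U p).trans_eq ?_
  simp only [collisionProb_insertPaulis hU, ← Finset.sum_mul, sum_prod_stdSimplex, one_mul]

/-- Only the positions of the nonzero entries of a Pauli string matter for its effect on the
diagonal, so that a Pauli string inserted after the last layer commutes with the noise there. -/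
lemma outputProb_insertPaulis_last (U : Fin (d + 1) → QubitMatrix n)
    (p : Fin (d + 1) → stdSimplex ℝ (PauliString n)) {T : Fin (d + 1) → PauliString n}
    (hT : ∀ m : Fin d, (T m.castSucc).toMatrix = 1) (x : BitString n) :
    outputProb (insertPaulis T U) (fun m => pauliChannel (p m)) x =
      outputProb U (fun m => pauliChannel (p m)) (x + (T (Fin.last d)).flip) := by
  have h : (fun m : Fin d => insertPaulis T U m.castSucc) = fun m => U m.castSucc :=
    funext fun m => by rw [insertPaulis, hT, Matrix.one_mul]
  have h' (V W σ : QubitMatrix n) : V * W * σ * (V * W)ᴴ = V * (W * σ * Wᴴ) * Vᴴ := by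
    simp only [Matrix.conjTranspose_mul, Matrix.mul_assoc]
  simp only [outputProb, outputState_succ, h]
  simp only [insertPaulis, h', pauliChannel, Matrix.sum_apply, Matrix.smul_apply,
    PauliString.conj_apply_diag, add_right_comm]

lemma exists_outputProb_insertPaulis (hd : d ≠ 0) (x : BitString n) :
    ∃ T : Fin d → PauliString n, ∀ (U : Fin d → QubitMatrix n)
      (p : Fin d → stdSimplex ℝ (PauliString n)),
        outputProb (insertPaulis T U) (fun m => pauliChannel (p m)) 0 =
          outputProb U (fun m => pauliChannel (p m)) x := by
  obtain ⟨d, rfl⟩ := Nat.exists_eq_succ_of_ne_zero hd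
  refine ⟨Fin.snoc (fun _ => PauliString.ofBits 0) (PauliString.ofBits x), fun U p => ?_⟩
  rw [outputProb_insertPaulis_last U p (fun m => by simp) 0, Fin.snoc_last,
    PauliString.flip_ofBits, zero_add]

/-! ### Continuity in the layers -/

lemma continuous_outputState {X : Type*} [TopologicalSpace X] {U : X → Fin d → QubitMatrix n}
    (hU : Continuous U) {𝓔 : Fin d → QubitMatrix n → QubitMatrix n}
    (h𝓔 : ∀ m, Continuous (𝓔 m)) : Continuous fun u => outputState (U u) 𝓔 := by
  induction d with
  | zero => simpa [outputState] using continuous_const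
  | succ d ih =>
    have h := ih (U := fun u m => U u m.castSucc) (by fun_prop) fun m => h𝓔 m.castSucc
    have hl : Continuous fun u => U u (Fin.last d) := by fun_prop
    simp only [outputState_succ]
    exact (h𝓔 _).comp ((hl.matrix_mul h).matrix_mul hl.matrix_conjTranspose)

lemma continuous_pauliChannel (q : stdSimplex ℝ (PauliString n)) :
    Continuous (pauliChannel q) := by
  unfold pauliChannel
  fun_prop

lemma continuous_outputProb {X : Type*} [TopologicalSpace X] {U : X → Fin d → QubitMatrix n}
    (hU : Continuous U) {𝓔 : Fin d → QubitMatrix n → QubitMatrix n}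
    (h𝓔 : ∀ m, Continuous (𝓔 m)) (x : BitString n) :
    Continuous fun u => outputProb (U u) 𝓔 x :=
  Complex.continuous_re.comp ((continuous_outputState hU h𝓔).matrix_elem x x)

end Circuit

/-! ### Layers of two-qubit gates -/

namespace ParallelArchitecture

variable (A : ParallelArchitecture)

/-- Bit strings grouped according to the pairs of qubits of a layer. -/
def groupBits (m : Fin A.d) : (Fin (A.n / 2) → BitString 2) ≃ BitString A.n :=
  (Equiv.curry _ _ _).symm.trans ((A.wire m).arrowCongr (Equiv.refl _))

lemma groupBits_wire (m : Fin A.d) (z : Fin (A.n / 2) → BitString 2) (g : Fin (A.n / 2))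
    (b : Fin 2) : A.groupBits m z (A.wire m (g, b)) = z g b := by
  simp [groupBits, Equiv.arrowCongr, Function.uncurry]

lemma layer_mul (u v : A.Gates) (m : Fin A.d) :
    A.layer (u * v) m = A.layer u m * A.layer v m := by
  ext x y
  simp only [layer, Matrix.of_apply, Matrix.mul_apply, Pi.mul_apply, Submonoid.coe_mul,
    Fintype.prod_sum]
  rw [← (A.groupBits m).sum_comp]
  simp only [groupBits_wire, Finset.prod_mul_distrib]

lemma layer_one (m : Fin A.d) : A.layer 1 m = 1 := by
  ext x y
  simp only [layer, Matrix.of_apply, Pi.one_apply, OneMemClass.coe_one, Matrix.one_apply,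
    Finset.prod_ite_zero, Finset.prod_const_one, Finset.mem_univ, true_imp_iff]
  congr 1
  simp only [funext_iff, ← (A.wire m).forall_congr_right (q := fun i => x i = y i),
    Prod.forall]

lemma layer_inv (u : A.Gates) (m : Fin A.d) : A.layer u⁻¹ m = (A.layer u m)ᴴ := by
  ext x y
  simp [layer, Matrix.conjTranspose_apply, star_prod, Matrix.star_apply]

lemma layer_mem_unitaryGroup (u : A.Gates) (m : Fin A.d) :
    A.layer u m ∈ Matrix.unitaryGroup (BitString A.n) ℂ := by
  rw [Matrix.mem_unitaryGroup_iff, Matrix.star_eq_conjTranspose, ← layer_inv, ← layer_mul,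
    mul_inv_cancel, layer_one]

/-- Two-qubit gates whose layers are the given Pauli strings. -/
def pauliGates (E : Fin A.d → PauliString A.n) : A.Gates := fun m g =>
  ⟨PauliString.toMatrix fun b => E m (A.wire m (g, b)), PauliString.toMatrix_mem_unitaryGroup _⟩

lemma layer_pauliGates (E : Fin A.d → PauliString A.n) (m : Fin A.d) :
    A.layer (A.pauliGates E) m = (E m).toMatrix := by
  ext x y
  simp only [layer, pauliGates, PauliString.toMatrix, Matrix.of_apply]
  rw [← (A.wire m).prod_comp, Fintype.prod_prod_type]

lemma layer_pauliGates_mul (E : Fin A.d → PauliString A.n) (u : A.Gates) :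
    A.layer (A.pauliGates E * u) = insertPaulis E (A.layer u) :=
  funext fun m => by rw [layer_mul, layer_pauliGates, insertPaulis]

lemma continuous_layer : Continuous A.layer := by
  refine continuous_pi fun m => continuous_matrix fun x y => ?_
  simp only [layer, Matrix.of_apply]
  refine continuous_finsetProd _ fun g _ => ?_
  have h : Continuous fun u : A.Gates => u m g := by fun_prop
  exact (continuous_subtype_val.comp h).matrix_elem _ _

/-! ### Expectations over the Haar ensemble -/

instance : SecondCountableTopology TwoQubitGate :=
  haveI : SecondCountableTopology (Matrix (BitString 2) (BitString 2) ℂ) :=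
    inferInstanceAs (SecondCountableTopology (BitString 2 → BitString 2 → ℂ))
  TopologicalSpace.Subtype.secondCountableTopology
    (Matrix.unitaryGroup (BitString 2) ℂ : Set (Matrix (BitString 2) (BitString 2) ℂ))

instance : haarGate.IsMulLeftInvariant := by unfold haarGate; infer_instance

instance : IsProbabilityMeasure A.haar := by unfold haar; infer_instance

instance : A.haar.IsMulLeftInvariant := by
  unfold haar
  exact Measure.pi.isMulLeftInvariant _

lemma integrable_of_continuous {f : A.Gates → ℝ} (hf : Continuous f) : Integrable f A.haar :=
  hf.integrable_of_hasCompactSupport (HasCompactSupport.of_compactSpace f)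

lemma integral_insertPaulis (E : Fin A.d → PauliString A.n)
    (f : (Fin A.d → QubitMatrix A.n) → ℝ) :
    ∫ u, f (insertPaulis E (A.layer u)) ∂A.haar = ∫ u, f (A.layer u) ∂A.haar := by
  simp only [← layer_pauliGates_mul]
  exact integral_mul_left_eq_self (fun u => f (A.layer u)) (A.pauliGates E)

variable {A}

lemma continuous_outputProb_layer {𝓔 : A.Channels} (h𝓔 : ∀ m, Continuous (𝓔 m))
    (x : BitString A.n) : Continuous fun u => outputProb (A.layer u) 𝓔 x :=
  continuous_outputProb A.continuous_layer h𝓔 x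

lemma integrable_collisionProb {𝓔 : A.Channels} (h𝓔 : ∀ m, Continuous (𝓔 m)) :
    Integrable (fun u => collisionProb (A.layer u) 𝓔) A.haar :=
  A.integrable_of_continuous <|
    continuous_finsetSum _ fun x _ => (continuous_outputProb_layer h𝓔 x).pow 2

lemma continuous_channels (p : A.PauliNoise) (m : Fin A.d) : Continuous (p.channels m) :=
  continuous_pauliChannel (p m)

theorem inv_two_pow_le_expCollision (p : A.PauliNoise) :
    (2 ^ A.n : ℝ)⁻¹ ≤ A.expCollision p.channels := by
  have h := integral_mono (μ := A.haar) (integrable_const ((2 ^ A.n : ℝ)⁻¹))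
    (integrable_collisionProb (continuous_channels p)) fun u =>
      inv_two_pow_le_collisionProb (sum_outputProb_pauliChannel (A.layer_mem_unitaryGroup u) p)
  simpa [expCollision] using h

/-- Left invariance of the Haar measure absorbs every Pauli string that the expansion of the noise
inserts into the circuit. -/
theorem expCollision_channels_le (p : A.PauliNoise) :
    A.expCollision p.channels ≤ A.expCollision A.noiseless := by
  have hint (E : Fin A.d → PauliString A.n) : Integrable
      (fun u => collisionProb (insertPaulis E (A.layer u)) A.noiseless) A.haar := by
    simp only [← layer_pauliGates_mul]
    exact (integrable_collisionProb (𝓔 := A.noiseless) fun _ => continuous_id).comp_mul_left _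
  calc A.expCollision p.channels
      ≤ ∫ u, ∑ E : Fin A.d → PauliString A.n, (∏ m, (p m).1 (E m)) *
          collisionProb (insertPaulis E (A.layer u)) A.noiseless ∂A.haar :=
        integral_mono (integrable_collisionProb (continuous_channels p))
          (integrable_finsetSum _ fun E _ => (hint E).const_mul _)
          fun u => collisionProb_pauliChannel_le (A.layer u) p
    _ = A.expCollision A.noiseless := by
        rw [integral_finsetSum _ fun E _ => (hint E).const_mul _]
        simp only [integral_const_mul]
        simp only [A.integral_insertPaulis _ fun U => collisionProb U A.noiseless,
          ← Finset.sum_mul, sum_prod_stdSimplex, one_mul, expCollision]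

/-- All output probabilities are identically distributed once there is a layer of gates: the
layer may be followed by `X` gates. -/
lemma integral_outputProb_eq (hd : A.d ≠ 0) (p : A.PauliNoise) (f : ℝ → ℝ) (x : BitString A.n) :
    ∫ u, f (outputProb (A.layer u) p.channels x) ∂A.haar =
      ∫ u, f (outputProb (A.layer u) p.channels 0) ∂A.haar := by
  obtain ⟨T, hT⟩ := exists_outputProb_insertPaulis (n := A.n) hd x
  rw [← A.integral_insertPaulis T fun U => f (outputProb U p.channels 0)]
  exact integral_congr_ae (.of_forall fun u => congr_arg f (hT (A.layer u) p).symm)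

lemma integral_outputProb_zero (hd : A.d ≠ 0) (p : A.PauliNoise) :
    2 ^ A.n * ∫ u, outputProb (A.layer u) p.channels 0 ∂A.haar = 1 := by
  have h : ∫ u, ∑ x, outputProb (A.layer u) p.channels x ∂A.haar = 1 := by
    have h1 (u : A.Gates) : ∑ x, outputProb (A.layer u) p.channels x = 1 :=
      sum_outputProb_pauliChannel (A.layer_mem_unitaryGroup u) p
    simp [h1]
  rw [integral_finsetSum _ fun x _ => A.integrable_of_continuous
    (continuous_outputProb_layer (continuous_channels p) x)] at h
  simpa [integral_outputProb_eq hd p fun t => t] using h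

lemma integral_outputProb_zero_sq (hd : A.d ≠ 0) (p : A.PauliNoise) :
    2 ^ A.n * ∫ u, outputProb (A.layer u) p.channels 0 ^ 2 ∂A.haar =
      A.expCollision p.channels := by
  simp only [expCollision, collisionProb]
  have hint (x : BitString A.n) :
      Integrable (fun u => outputProb (A.layer u) p.channels x ^ 2) A.haar :=
    A.integrable_of_continuous ((continuous_outputProb_layer (continuous_channels p) x).pow 2)
  rw [integral_finsetSum _ fun x _ => hint x]
  simp [integral_outputProb_eq hd p fun t => t ^ 2]

end ParallelArchitecture

/-! ### Anticoncentration from the second moment -/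

/-- The **Paley–Zygmund inequality** for a real random variable that may take negative values. -/
theorem sq_integral_sub_le_integral_sq_mul {Ω : Type*} [MeasurableSpace Ω] {μ : Measure Ω}
    [IsProbabilityMeasure μ] {f : Ω → ℝ} (hf : MemLp f 2 μ) {t : ℝ} (ht : 0 ≤ t)
    (ht' : t ≤ ∫ ω, f ω ∂μ) (hm : MeasurableSet {ω | t ≤ f ω}) :
    ((∫ ω, f ω ∂μ) - t) ^ 2 ≤ (∫ ω, f ω ^ 2 ∂μ) * μ.real {ω | t ≤ f ω} := by
  set S := {ω | t ≤ f ω}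
  have hfi : Integrable f μ := hf.integrable one_le_two
  have hmean : (∫ ω, f ω ∂μ) - t ≤ ∫ ω, S.indicator f ω ∂μ := by
    have h : ∫ ω, f ω ∂μ ≤ ∫ ω, (t + S.indicator f ω) ∂μ := by
      refine integral_mono hfi ((integrable_const t).add (hfi.indicator hm)) fun ω => ?_
      by_cases hω : ω ∈ S
      · simpa [hω] using ht
      · simpa [hω] using (not_le.mp hω).le
    rw [integral_add (integrable_const t) (hfi.indicator hm)] at h
    simp only [integral_const, probReal_univ, one_smul] at h
    linarith
  -- Cauchy–Schwarz for `f` and the indicator of `S`, through the discriminant of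
  -- `s ↦ ∫ (f - s 1_S) ^ 2`.
  have hquad (s : ℝ) : 0 ≤ μ.real S * (s * s) + (-2 * ∫ ω, S.indicator f ω ∂μ) * s +
      ∫ ω, f ω ^ 2 ∂μ := by
    have h : 0 ≤ ∫ ω, (s * s * S.indicator 1 ω + -2 * s * S.indicator f ω + f ω ^ 2) ∂μ := by
      refine integral_nonneg fun ω => ?_
      by_cases hω : ω ∈ S
      · simp only [hω, Set.indicator_of_mem, Pi.one_apply, Pi.zero_apply]
        nlinarith [sq_nonneg (f ω - s)]
      · simpa [hω] using sq_nonneg (f ω)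
    have h1 : Integrable (fun ω => s * s * S.indicator (1 : Ω → ℝ) ω) μ :=
      ((integrable_const (1 : ℝ)).indicator hm).const_mul _
    have h2 : Integrable (fun ω => -2 * s * S.indicator f ω) μ := (hfi.indicator hm).const_mul _
    have h12 : Integrable (fun ω => s * s * S.indicator (1 : Ω → ℝ) ω +
        -2 * s * S.indicator f ω) μ := h1.add h2
    rw [integral_add h12 hf.integrable_sq, integral_add h1 h2, integral_const_mul,
      integral_const_mul, integral_indicator_one hm] at h
    linarith
  have hdiscrim := discrim_le_zero hquad
  rw [discrim] at hdiscrim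
  nlinarith [pow_le_pow_left₀ (sub_nonneg.mpr ht') hmean 2]

namespace ParallelArchitecture

variable {A : ParallelArchitecture}

theorem le_probZeroGe (p : A.PauliNoise) {c : ℝ} (hc : 2 ^ A.n * A.expCollision p.channels ≤ c)
    {α : ℝ} (h0 : 0 ≤ α) (h1 : α ≤ 1) :
    (1 - α) ^ 2 / c ≤ A.probZeroGe p.channels (α / 2 ^ A.n) := by
  have hN : (0 : ℝ) < 2 ^ A.n := by positivity
  have hc1 : 1 ≤ c := by
    refine le_trans ?_ hc
    rw [← inv_le_iff_one_le_mul₀' hN]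
    exact inv_two_pow_le_expCollision p
  rw [div_le_iff₀' (by linarith)]
  by_cases hd : A.d = 0
  · -- Without layers the output is `0…0` with certainty.
    have hp (u : A.Gates) : outputProb (A.layer u) p.channels 0 = 1 := by
      obtain ⟨n, hn, d, wire⟩ := A
      subst hd
      simp [outputProb, outputState]
    have hα : α / 2 ^ A.n ≤ 1 := (div_le_one hN).mpr (h1.trans (one_le_pow₀ one_le_two))
    simp only [probZeroGe, hp, hα, Set.ofPred_true, probReal_univ]
    nlinarith
  · have hcont := continuous_outputProb_layer (continuous_channels p) 0
    have hmean := integral_outputProb_zero hd p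
    have hsq := integral_outputProb_zero_sq hd p
    have hmean' : ∫ u, outputProb (A.layer u) p.channels 0 ∂A.haar = 1 / 2 ^ A.n := by
      rw [eq_div_iff hN.ne', mul_comm, hmean]
    have h := sq_integral_sub_le_integral_sq_mul (μ := A.haar) (t := α / 2 ^ A.n)
      ((memLp_two_iff_integrable_sq hcont.aestronglyMeasurable).mpr
        (A.integrable_of_continuous (hcont.pow 2)))
      (by positivity) (by rw [hmean']; gcongr) (isClosed_le continuous_const hcont).measurableSet
    rw [hmean', ← sub_div, div_pow, div_le_iff₀ (by positivity)] at h
    refine h.trans ?_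
    change _ * A.probZeroGe p.channels (α / 2 ^ A.n) * _ ≤ _
    have hP : 0 ≤ A.probZeroGe p.channels (α / 2 ^ A.n) := measureReal_nonneg
    calc _ = 2 ^ A.n * A.expCollision p.channels * A.probZeroGe p.channels (α / 2 ^ A.n) := by
          rw [← hsq]; ring
      _ ≤ _ := mul_le_mul_of_nonneg_right hc hP

end ParallelArchitecture

/-! ### Noisy circuits anticoncentrate -/

theorem mainTheorem4 :
    -- Haar-random circuits with Pauli noise anticoncentrate at least as fast as without noise
    (∀ (A : ParallelArchitecture) (p : A.PauliNoise),
      (2 ^ A.n : ℝ)⁻¹ ≤ A.expCollision p.channels ∧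
      A.expCollision p.channels ≤ A.expCollision A.noiseless) ∧
    -- quantitative anticoncentration of a single noisy ensemble
    (∀ (A : ParallelArchitecture) (p : A.PauliNoise) (c : ℝ),
      2 ^ A.n * A.expCollision A.noiseless ≤ c →
        A.expCollision p.channels ≤ c * (2 ^ A.n : ℝ)⁻¹ ∧
        ∀ α : ℝ, 0 ≤ α → α ≤ 1 →
          (1 - α) ^ 2 / c ≤ A.probZeroGe p.channels (α / 2 ^ A.n)) ∧
    -- anticoncentration of a family of noisy ensembles
    (∀ {ι : Type*} (A : ι → ParallelArchitecture) (p : ∀ k, (A k).PauliNoise),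
      (∃ c : ℝ, ∀ k, 2 ^ (A k).n * (A k).expCollision (A k).noiseless ≤ c) →
        IsAnticoncentrated A fun k => (p k).channels) ∧
    -- Pauli noise cannot increase the collision probability of a Clifford circuit
    (∀ (n d : ℕ) (U : Fin d → QubitMatrix n) (p : Fin d → stdSimplex ℝ (PauliString n)),
      (∀ m, IsClifford (U m)) →
        collisionProb U (fun m => pauliChannel (p m)) ≤ collisionProb U (fun _ => id)) := by
  have key (A : ParallelArchitecture) (p : A.PauliNoise) {c : ℝ}
      (hc : 2 ^ A.n * A.expCollision A.noiseless ≤ c) :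
      2 ^ A.n * A.expCollision p.channels ≤ c :=
    (mul_le_mul_of_nonneg_left (ParallelArchitecture.expCollision_channels_le p)
      (by positivity)).trans hc
  refine ⟨fun A p => ⟨ParallelArchitecture.inv_two_pow_le_expCollision p,
      ParallelArchitecture.expCollision_channels_le p⟩,
    fun A p c hc => ⟨?_, fun α h0 h1 =>
      ParallelArchitecture.le_probZeroGe p (key A p hc) h0 h1⟩, ?_,
    fun n d U p hU => collisionProb_pauliChannel_le_of_isClifford hU p⟩
  · rw [← div_eq_mul_inv, le_div_iff₀' (by positivity)]
    exact key A p hc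
  · rintro ι A p ⟨c, hc⟩
    -- Any `α` in `(0, 1)` would do; the maximum matters for an empty family, where `c` may be negative.
    refine ⟨1 / 2, by norm_num, (1 - 1 / 2) ^ 2 / max c 1, by positivity, fun k => ?_⟩
    exact ParallelArchitecture.le_probZeroGe (p k)
      (key (A k) (p k) ((hc k).trans (le_max_left _ _)))
      (by norm_num) (by norm_num)

end
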